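/- Let $k\ge 1$ be an integer and let $\zeta$ be the Riemann zeta function. Put $$\Delta_{2k}=\{(t_1,\dots,t_{2k})\in(0,1)^{2k} : t_1<t_2>t_3<t_4>\cdots>t_{2k-1}<t_{2k}\},$$ $$\Delta_{2k+1}=\{(t_1,\dots,t_{2k+1})\in(0,1)^{2k+1} : t_{2i}>t_{2i-1},\ t_{2i}>t_{2i+1}\ \text{for } i=1,\dots,k\}.$$ Then the following integrals with respect to Lebesgue measure converge absolutely, and: (i) $$\zeta(2k)=\frac{1}{2(1-2^{1-2k})}\int_{\Delta_{2k}}\frac{dt_1}{1-t_1}\frac{dt_2}{t_2}\frac{dt_3}{1-t_3}\frac{dt_4}{t_4}\cdots\frac{dt_{2k-1}}{1-t_{2k-1}}\frac{dt_{2k}}{t_{2k}};$$ (ii) $$\zeta(2k+1)=\frac12\int_{\Delta_{2k+1}}\frac{dt_1}{1-t_1}\frac{dt_2}{t_2}\cdots\frac{dt_{2k-1}}{1-t_{2k-1}}\frac{dt_{2k}}{t_{2k}}\frac{dt_{2k+1}}{1-t_{2k+1}}.$$ -/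

import Mathlib

open MeasureTheory

/-- The zigzag region `t₁ < t₂ > t₃ < t₄ > ⋯` in the open unit cube `(0,1)ⁿ`. The coordinate `t_{m+1}`
is `t m` for `m : Fin n`, so the odd-numbered coordinates are the `t i` with `i` even; each of them
is smaller than its (one or two) neighbours. -/
def zigzagRegion (n : ℕ) : Set (Fin n → ℝ) :=
  {t | (∀ i, t i ∈ Set.Ioo (0 : ℝ) 1) ∧
    ∀ i j : Fin n, Even (i : ℕ) → ((j : ℕ) = i + 1 ∨ (i : ℕ) = j + 1) → t i < t j}

/-- The density of `dt₁/(1-t₁) · dt₂/t₂ · dt₃/(1-t₃) ⋯` in `n` variables: a factor `1/(1-t)` for each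
odd-numbered coordinate and a factor `1/t` for each even-numbered one. -/
noncomputable def zigzagDensity (n : ℕ) (t : Fin n → ℝ) : ℝ :=
  ∏ i : Fin n, if Even (i : ℕ) then 1 / (1 - t i) else 1 / t i

/-! Replacing each even-numbered `t` by `1 - t` turns the zigzag into the conditions `uᵢ + uᵢ₊₁ < 1`
with density `∏ 1/(1 - uᵢ)`. Let `Iₙ(s)` be this integral with the extra constraint `u₁ < 1 - s`.
Then `Iₙ₊₁ = T Iₙ`, where `(T f)(s) = ∫₀^{1-s} f(x)/(1-x) dx`.

The polynomials `pₘ = ₂F₁(m,-m;1;·)`, `m ≥ 1`, are eigenfunctions of `T`: the reflection identity `x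
pₘ'(x) = (-1)^m m pₘ(1-x)` and `pₘ(1) = 0` give the eigenvalue `(-1)^(m+1)/m`
(`eigenPoly_reflection`, `eval_one_eigenPoly`). It remains to expand one `Iₙ`. For `n = 2`, `I₂ =
ζ(2) - Li₂`, and `pₘ(u)` is the mean over `φ` of `cos 2mθ`, where `sin θ = √u sin φ`. Averaging the
Fourier series of `π²/6 - 2θ²`, together with the power series of `arcsin²`, yields `I₂ = ∑
2(-1)^(m+1)/m² pₘ` (`hasSum_eigenPoly_dilog`).

Applying `T` repeatedly and using `pₘ(0) = 1` gives `Iₙ(0) = 2 ∑ (-1)^((m+1)(n+1)) / m^n`: this is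
`2ζ(n)` for odd `n` and twice the alternating zeta value for even `n`. -/

/-! ### Eigenpolynomials and their reflection identity. -/

/-- The coefficients of the hypergeometric polynomial `₂F₁(m, -m; 1; u)`. -/
noncomputable def eigenCoeff (m j : ℕ) : ℝ :=
  ∏ i ∈ Finset.range j, ((i : ℝ) ^ 2 - (m : ℝ) ^ 2) / ((i : ℝ) + 1) ^ 2

theorem eigenCoeff_zero (m : ℕ) : eigenCoeff m 0 = 1 := by simp [eigenCoeff]

theorem eigenCoeff_succ (m j : ℕ) :
    ((j : ℝ) + 1) ^ 2 * eigenCoeff m (j + 1) = ((j : ℝ) ^ 2 - (m : ℝ) ^ 2) * eigenCoeff m j := by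
  have h : ((j : ℝ) + 1) ≠ 0 := by positivity
  rw [eigenCoeff, Finset.prod_range_succ, ← eigenCoeff]
  field_simp

theorem eigenCoeff_eq_zero {m j : ℕ} (h : m < j) : eigenCoeff m j = 0 :=
  Finset.prod_eq_zero (Finset.mem_range.2 h) (by simp)

theorem eigenCoeff_ne_zero {m j : ℕ} (h : j ≤ m) : eigenCoeff m j ≠ 0 := by
  refine Finset.prod_ne_zero_iff.2 fun i hi => ?_
  have hi' : i < m := (Finset.mem_range.1 hi).trans_le h
  have h1 : (i : ℝ) < m := by exact_mod_cast hi'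
  have h2 : (0 : ℝ) ≤ i := by positivity
  have h3 : (i : ℝ) ^ 2 - (m : ℝ) ^ 2 ≠ 0 := by nlinarith
  positivity

/-- The polynomial `₂F₁(m, -m; 1; X)`. -/
noncomputable def eigenPoly (m : ℕ) : Polynomial ℝ :=
  ∑ j ∈ Finset.range (m + 1), Polynomial.C (eigenCoeff m j) * Polynomial.X ^ j

theorem coeff_eigenPoly (m j : ℕ) : (eigenPoly m).coeff j = eigenCoeff m j := by
  simp only [eigenPoly, Polynomial.finsetSum_coeff, Polynomial.coeff_C_mul_X_pow]
  rw [Finset.sum_ite_eq]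
  split_ifs with h
  · rfl
  · exact (eigenCoeff_eq_zero (by simpa using h)).symm

theorem eval_eigenPoly (m : ℕ) (u : ℝ) :
    (eigenPoly m).eval u = ∑ j ∈ Finset.range (m + 1), eigenCoeff m j * u ^ j := by
  simp [eigenPoly, Polynomial.eval_finsetSum]

theorem eval_zero_eigenPoly (m : ℕ) : (eigenPoly m).eval 0 = 1 := by
  rw [← Polynomial.coeff_zero_eq_eval_zero, coeff_eigenPoly, eigenCoeff_zero]

-- The recursion determines `q` from its constant term, so polynomial solutions are unique up to a
-- scalar.
open Polynomial in
theorem hypergeometric_ode_iff_coeff (a : ℝ) (q : Polynomial ℝ) :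
    (1 - X) * derivative (X * derivative q) = C (-a) * q ↔
      ∀ j : ℕ, ((j : ℝ) + 1) ^ 2 * q.coeff (j + 1) = ((j : ℝ) ^ 2 - a) * q.coeff j := by
  rw [Polynomial.ext_iff]
  refine forall_congr' fun j => ?_
  rw [sub_mul, one_mul, coeff_sub, coeff_C_mul]
  rcases j with _ | j
  · simp only [coeff_derivative, coeff_X_mul, mul_coeff_zero, coeff_X_zero]
    push_cast
    constructor <;> intro h <;> linarith
  · simp only [coeff_derivative, coeff_X_mul]
    push_cast
    constructor <;> intro h <;> linarith

-- The reflected polynomial solves the same hypergeometric equation, hence is a multiple of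
-- `eigenPoly m`.
open Polynomial in
theorem eigenPoly_reflection (m : ℕ) :
    (X * derivative (eigenPoly m)).comp (1 - X) = C ((-1) ^ m * (m : ℝ)) * eigenPoly m := by
  have hode := (hypergeometric_ode_iff_coeff ((m : ℝ) ^ 2) (eigenPoly m)).2 fun j => by
    simpa only [coeff_eigenPoly] using eigenCoeff_succ m j
  set p := eigenPoly m with hp
  set s := (X * derivative p).comp (1 - X) with hs
  have h1 : X * derivative s = C ((m : ℝ) ^ 2) * p.comp (1 - X) := by
    have h := congrArg (fun q => q.comp (1 - X)) hode
    simp only [mul_comp, sub_comp, one_comp, X_comp, C_comp] at h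
    rw [hs, derivative_comp]
    simp only [map_sub, derivative_one, derivative_X, C_neg] at h ⊢
    linear_combination -h
  have h2 : (1 - X) * derivative (X * derivative s) = C (-(m : ℝ) ^ 2) * s := by
    rw [h1, derivative_mul, derivative_C, derivative_comp, hs]
    simp only [map_sub, derivative_one, derivative_X, C_neg, mul_comp, X_comp]
    ring
  have h3 := (hypergeometric_ode_iff_coeff ((m : ℝ) ^ 2) s).1 h2
  have h4 : ∀ j, s.coeff j = s.coeff 0 * eigenCoeff m j := by
    intro j
    induction j with
    | zero => simp [eigenCoeff_zero]
    | succ j ih =>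
      have hj : ((j : ℝ) + 1) ^ 2 ≠ 0 := by positivity
      refine mul_left_cancel₀ hj ?_
      rw [h3 j, ih]
      linear_combination (-s.coeff 0) * eigenCoeff_succ m j
  have h5 : s = C (s.coeff 0) * p := by
    ext j
    rw [h4 j, coeff_C_mul, hp, coeff_eigenPoly]
  suffices h : s.coeff 0 = (-1) ^ m * (m : ℝ) by rw [h5, h]
  have hr : ∀ j, (X * derivative p).coeff j = j * eigenCoeff m j := by
    intro j
    rcases j with _ | j
    · simp
    · rw [coeff_X_mul, coeff_derivative, hp, coeff_eigenPoly]
      push_cast; ring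
  have hdeg : (X * derivative p).natDegree ≤ m := by
    refine natDegree_le_iff_coeff_eq_zero.2 fun j hj => ?_
    rw [hr, eigenCoeff_eq_zero hj, mul_zero]
  -- The scalar is read off in degree `m`, where `X ↦ 1 - X` only contributes the sign `(-1)^m`.
  have hlead : s.coeff m = (-1) ^ m * (m * eigenCoeff m m) := by
    rw [hs, ← hr m]
    generalize X * derivative p = r at hdeg
    rw [comp_eq_sum_left, sum_over_range' _ (by simp) (m + 1) (by omega), finsetSum_coeff,
      Finset.sum_range_succ, Finset.sum_eq_zero, zero_add, coeff_C_mul]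
    · have : (1 - X : ℝ[X]) = C (-1) * (X - C 1) := by
        rw [C_neg, C_1]; ring
      rw [this, mul_pow, ← C_pow, coeff_C_mul]
      have h6 : ((X - C (1 : ℝ)) ^ m).coeff m = 1 := by
        have h7 := (monic_X_sub_C (1 : ℝ)).pow m
        have h8 : ((X - C (1 : ℝ)) ^ m).natDegree = m := by
          rw [natDegree_pow, natDegree_X_sub_C, mul_one]
        rwa [Monic, leadingCoeff, h8] at h7
      rw [h6]; ring
    · intro i hi
      rw [coeff_C_mul, coeff_eq_zero_of_natDegree_lt (p := (1 - X) ^ i), mul_zero]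
      have h1 : (1 - X : ℝ[X]).natDegree ≤ 1 := by compute_degree
      exact (natDegree_pow_le_of_le i h1).trans_lt (by simpa using hi)
  have h9 := h4 m
  rw [hlead] at h9
  exact mul_right_cancel₀ (eigenCoeff_ne_zero le_rfl) (by linear_combination -h9)

theorem eval_derivative_eigenPoly (m : ℕ) (x : ℝ) :
    x * (eigenPoly m).derivative.eval x = (-1) ^ m * m * (eigenPoly m).eval (1 - x) := by
  have h := congrArg (Polynomial.eval (1 - x)) (eigenPoly_reflection m)
  simpa [Polynomial.eval_comp] using h

theorem eval_one_eigenPoly {m : ℕ} (hm : m ≠ 0) : (eigenPoly m).eval 1 = 0 := by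
  have h := eval_derivative_eigenPoly m 0
  have : (m : ℝ) ≠ 0 := by exact_mod_cast hm
  simpa [this] using h

/-! ### Even sine polynomials and their means. -/

open Finset in
theorem hasDerivAt_sum_sin_pow (g : ℕ → ℝ) (N : ℕ) (θ : ℝ) :
    HasDerivAt (fun θ => ∑ j ∈ range N, g j * Real.sin θ ^ (2 * j))
      (∑ j ∈ range N, g j * (2 * j * Real.sin θ ^ (2 * j - 1) * Real.cos θ)) θ := by
  refine HasDerivAt.fun_sum fun j _ => HasDerivAt.const_mul _ ?_
  simpa using (Real.hasDerivAt_sin θ).fun_pow (2 * j)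

open Finset in
theorem hasDerivAt_sum_sin_pow_mul_cos (g : ℕ → ℝ) (N : ℕ) (θ : ℝ) :
    HasDerivAt (fun θ => ∑ j ∈ range N, g j * (2 * j * Real.sin θ ^ (2 * j - 1) * Real.cos θ))
      (∑ j ∈ range N, g j * (2 * j * (2 * j - 1) * Real.sin θ ^ (2 * j - 2) -
        4 * j ^ 2 * Real.sin θ ^ (2 * j))) θ := by
  refine HasDerivAt.fun_sum fun j _ => HasDerivAt.const_mul _ ?_
  rcases j with _ | j
  · simpa using hasDerivAt_const θ (0 : ℝ)
  · have h := (((Real.hasDerivAt_sin θ).fun_pow (2 * j + 1)).const_mul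
      (2 * ((j + 1 : ℕ) : ℝ))).fun_mul (Real.hasDerivAt_cos θ)
    convert! h using 1
    have h1 : 2 * (j + 1) - 2 = 2 * j := by omega
    have h2 : 2 * j + 1 - 1 = 2 * j := by omega
    rw [h1, h2]
    push_cast
    linear_combination (-(2 * (j : ℝ) + 2) * (2 * j + 1) * Real.sin θ ^ (2 * j)) *
      Real.sin_sq_add_cos_sq θ

-- The sum telescopes, leaving a boundary term in degree `2N`. It serves both `cos 2mθ` (`h =
-- -4m²g`) and `θ²` (`h` equal to 2 at `j = 0` only).
open Finset in
theorem sum_second_deriv_sin_pow {g h : ℕ → ℝ}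
    (hg : ∀ j : ℕ, (2 * (j : ℝ) + 2) * (2 * j + 1) * g (j + 1) = 4 * (j : ℝ) ^ 2 * g j + h j)
    (N : ℕ) (x : ℝ) :
    ∑ j ∈ range (N + 1), g j * (2 * j * (2 * j - 1) * x ^ (2 * j - 2) - 4 * j ^ 2 * x ^ (2 * j)) =
      ∑ j ∈ range N, h j * x ^ (2 * j) - 4 * N ^ 2 * g N * x ^ (2 * N) := by
  induction N with
  | zero => simp
  | succ N ih =>
    rw [sum_range_succ, ih, sum_range_succ]
    have h1 : 2 * (N + 1) - 2 = 2 * N := by omega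
    rw [h1]
    push_cast
    linear_combination x ^ (2 * N) * hg N

/-- The mean of `sin ^ (2 * j)` over a half period. -/
noncomputable def wallis (j : ℕ) : ℝ :=
  ∏ i ∈ Finset.range j, (2 * (i : ℝ) + 1) / (2 * i + 2)

theorem wallis_succ (j : ℕ) : wallis (j + 1) = wallis j * ((2 * (j : ℝ) + 1) / (2 * j + 2)) := by
  rw [wallis, Finset.prod_range_succ, ← wallis]

theorem wallis_pos (j : ℕ) : 0 < wallis j := Finset.prod_pos fun i _ => by positivity

theorem one_le_mul_wallis (j : ℕ) : 1 ≤ (2 * (j : ℝ) + 1) * wallis j := by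
  induction j with
  | zero => simp [wallis]
  | succ j ih =>
    have h := wallis_pos j
    have h2 : wallis (j + 1) * (2 * j + 2) = wallis j * (2 * j + 1) := by
      rw [wallis_succ]; field_simp
    have h3 := wallis_pos (j + 1)
    push_cast
    nlinarith

/-- The mean of a function over `(0, π)`. -/
noncomputable def halfMean (f : ℝ → ℝ) : ℝ := (1 / Real.pi) * ∫ φ in (0 : ℝ)..Real.pi, f φ

theorem halfMean_sin_pow (j : ℕ) : halfMean (fun φ => Real.sin φ ^ (2 * j)) = wallis j := by
  rw [halfMean, integral_sin_pow_even, wallis]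
  field_simp [Real.pi_ne_zero]

theorem abs_halfMean_le {f : ℝ → ℝ} {C : ℝ} (h : ∀ φ ∈ Set.Ioc 0 Real.pi, |f φ| ≤ C) :
    |halfMean f| ≤ C := by
  have h1 := intervalIntegral.norm_integral_le_of_norm_le_const (a := 0) (b := Real.pi) (f := f)
    (C := C) (by rwa [Set.uIoc_of_le Real.pi_pos.le])
  rw [sub_zero, abs_of_pos Real.pi_pos, Real.norm_eq_abs] at h1
  rw [halfMean, abs_mul, abs_of_pos (by positivity), one_div, inv_mul_le_iff₀ Real.pi_pos]
  linarith

/-- The amplitude: `sin (amplitude u φ) = √u * sin φ`. -/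
noncomputable def amplitude (u φ : ℝ) : ℝ := Real.arcsin (Real.sqrt u * Real.sin φ)

theorem continuous_amplitude (u : ℝ) : Continuous (amplitude u) := by
  unfold amplitude; fun_prop

theorem amplitude_mem {u φ : ℝ} (hφ : φ ∈ Set.Icc 0 Real.pi) :
    amplitude u φ ∈ Set.Icc 0 (Real.pi / 2) :=
  ⟨Real.arcsin_nonneg.2 (mul_nonneg (Real.sqrt_nonneg _) (Real.sin_nonneg_of_mem_Icc hφ)),
    Real.arcsin_le_pi_div_two _⟩

theorem sin_amplitude_sq {u : ℝ} (hu : u ∈ Set.Icc (0 : ℝ) 1) (φ : ℝ) :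
    Real.sin (amplitude u φ) ^ 2 = u * Real.sin φ ^ 2 := by
  have h : |Real.sqrt u * Real.sin φ| ≤ 1 := by
    rw [abs_mul, abs_of_nonneg (Real.sqrt_nonneg _)]
    exact mul_le_one₀ (Real.sqrt_le_one.2 hu.2) (abs_nonneg _) (Real.abs_sin_le_one _)
  rw [amplitude, Real.sin_arcsin (abs_le.1 h).1 (abs_le.1 h).2, mul_pow, Real.sq_sqrt hu.1]

/-- Averaging multiplies the `j`-th coefficient by `wallis j`, turning trigonometric expansions in
`θ` into power series in `u`. -/
theorem halfMean_sum_sin_amplitude_pow {u : ℝ} (hu : u ∈ Set.Icc (0 : ℝ) 1) (g : ℕ → ℝ) (N : ℕ) :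
    halfMean (fun φ => ∑ j ∈ Finset.range N, g j * Real.sin (amplitude u φ) ^ (2 * j)) =
      ∑ j ∈ Finset.range N, g j * wallis j * u ^ j := by
  simp only [pow_mul, sin_amplitude_sq hu, mul_pow]
  rw [halfMean, intervalIntegral.integral_finsetSum, Finset.mul_sum]
  · refine Finset.sum_congr rfl fun j _ => ?_
    rw [← halfMean_sin_pow, halfMean, intervalIntegral.integral_const_mul,
      intervalIntegral.integral_const_mul]
    simp only [pow_mul]
    ring
  · intro j _
    exact Continuous.intervalIntegrable (by fun_prop) _ _

/-- Both sides solve `y'' = -4m²y` with `y(0) = 1`, `y'(0) = 0`. -/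
theorem cos_two_mul_eq_sum (m : ℕ) (θ : ℝ) :
    Real.cos (2 * m * θ) = ∑ j ∈ Finset.range (m + 1),
      eigenCoeff m j / wallis j * Real.sin θ ^ (2 * j) := by
  rcases Nat.eq_zero_or_pos m with rfl | hm
  · simp [eigenCoeff, wallis]
  have hm0 : (m : ℝ) ≠ 0 := by positivity
  set g : ℕ → ℝ := fun j => eigenCoeff m j / wallis j with hg
  have hrec : ∀ j : ℕ, (2 * (j : ℝ) + 2) * (2 * j + 1) * g (j + 1) =
      4 * (j : ℝ) ^ 2 * g j + (-4 * (m : ℝ) ^ 2 * g j) := by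
    intro j
    have h1 := eigenCoeff_succ m j
    have h2 := (wallis_pos j).ne'
    simp only [hg, wallis_succ]
    field_simp
    linear_combination 4 * h1
  set G : ℝ → ℝ := fun θ => ∑ j ∈ Finset.range (m + 1), g j * Real.sin θ ^ (2 * j) with hG
  set G' : ℝ → ℝ := fun θ => ∑ j ∈ Finset.range (m + 1),
    g j * (2 * j * Real.sin θ ^ (2 * j - 1) * Real.cos θ) with hG'
  have d1 : ∀ θ, HasDerivAt G (G' θ) θ := hasDerivAt_sum_sin_pow g _
  have d2 : ∀ θ, HasDerivAt G' (-4 * (m : ℝ) ^ 2 * G θ) θ := by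
    intro θ
    convert! hasDerivAt_sum_sin_pow_mul_cos g (m + 1) θ using 1
    rw [sum_second_deriv_sin_pow hrec, hG]
    simp only [Finset.sum_range_succ _ m, mul_add, Finset.mul_sum, mul_assoc]
    ring
  have hc : ∀ θ : ℝ, HasDerivAt (fun θ : ℝ => Real.cos (2 * m * θ))
      (-(2 * m) * Real.sin (2 * m * θ)) θ := fun θ => by
    have := (Real.hasDerivAt_cos (2 * m * θ)).comp θ ((hasDerivAt_id θ).const_mul (2 * (m : ℝ)))
    convert! this using 1; ring
  have hs : ∀ θ : ℝ, HasDerivAt (fun θ : ℝ => Real.sin (2 * m * θ))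
      (2 * m * Real.cos (2 * m * θ)) θ := fun θ => by
    have := (Real.hasDerivAt_sin (2 * m * θ)).comp θ ((hasDerivAt_id θ).const_mul (2 * (m : ℝ)))
    convert! this using 1; ring
  -- Two first integrals of the equation; eliminating `G'` between them leaves `G = cos 2mθ`.
  have dA : ∀ θ, HasDerivAt (fun θ => 2 * m * (G θ * Real.cos (2 * m * θ)) -
      G' θ * Real.sin (2 * m * θ)) 0 θ := fun θ => by
    convert! (((d1 θ).fun_mul (hc θ)).const_mul (2 * (m : ℝ))).fun_sub ((d2 θ).fun_mul (hs θ))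
      using 1
    ring
  have dB : ∀ θ, HasDerivAt (fun θ => 2 * m * (G θ * Real.sin (2 * m * θ)) +
      G' θ * Real.cos (2 * m * θ)) 0 θ := fun θ => by
    convert! (((d1 θ).fun_mul (hs θ)).const_mul (2 * (m : ℝ))).fun_add ((d2 θ).fun_mul (hc θ))
      using 1
    ring
  have hG0 : G 0 = 1 := by
    simp [hG, hg, Finset.sum_range_succ', eigenCoeff_zero, wallis]
  have hG'0 : G' 0 = 0 := by
    simp only [hG']
    refine Finset.sum_eq_zero fun j _ => ?_
    rcases j with _ | j
    · simp
    · simp [show 2 * (j + 1) - 1 = 2 * j + 1 by omega]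
  have eA := is_const_of_deriv_eq_zero (fun θ => (dA θ).differentiableAt)
    (fun θ => (dA θ).deriv) θ 0
  have eB := is_const_of_deriv_eq_zero (fun θ => (dB θ).differentiableAt)
    (fun θ => (dB θ).deriv) θ 0
  simp only [hG0, hG'0, mul_zero, Real.cos_zero, Real.sin_zero, mul_one, sub_zero, add_zero]
    at eA eB
  have : 2 * (m : ℝ) * G θ = 2 * m * Real.cos (2 * m * θ) := by
    linear_combination Real.cos (2 * m * θ) * eA + Real.sin (2 * m * θ) * eB -
      2 * m * G θ * Real.sin_sq_add_cos_sq (2 * m * θ)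
  exact (mul_left_cancel₀ (by positivity) this).symm

/-- This representation transfers Fourier series to the eigenpolynomials and bounds them by 1 on
`[0,1]`. -/
theorem halfMean_cos_amplitude {u : ℝ} (hu : u ∈ Set.Icc (0 : ℝ) 1) (m : ℕ) :
    halfMean (fun φ => Real.cos (2 * m * amplitude u φ)) = (eigenPoly m).eval u := by
  simp only [cos_two_mul_eq_sum]
  rw [halfMean_sum_sin_amplitude_pow hu, eval_eigenPoly]
  refine Finset.sum_congr rfl fun j _ => ?_
  rw [div_mul_cancel₀ _ (wallis_pos j).ne']

theorem abs_eval_eigenPoly_le {u : ℝ} (hu : u ∈ Set.Icc (0 : ℝ) 1) (m : ℕ) :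
    |(eigenPoly m).eval u| ≤ 1 := by
  rw [← halfMean_cos_amplitude hu]
  exact abs_halfMean_le fun φ _ => Real.abs_cos_le_one _

/-! ### The dilogarithm and its eigenfunction expansion. -/

/-- Partial sums of the power series of `arcsin ^ 2`, with remainder. -/
theorem abs_sq_sub_sum_sin_pow_le {θ : ℝ} (hθ : θ ∈ Set.Icc 0 (Real.pi / 2)) {N : ℕ} (hN : N ≠ 0) :
    |θ ^ 2 - ∑ j ∈ Finset.range (N + 1),
      1 / (2 * (j : ℝ) ^ 2 * wallis j) * Real.sin θ ^ (2 * j)| ≤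
      2 * (2 * N + 1) * Real.sin θ ^ (2 * N) * θ ^ 2 := by
  -- Division by zero gives `g 0 = 0`, the correct constant term.
  set g : ℕ → ℝ := fun j => 1 / (2 * (j : ℝ) ^ 2 * wallis j) with hg
  have hrec : ∀ j : ℕ, (2 * (j : ℝ) + 2) * (2 * j + 1) * g (j + 1) =
      4 * (j : ℝ) ^ 2 * g j + (if j = 0 then 2 else 0) := by
    intro j
    have h2 := (wallis_pos j).ne'
    rcases Nat.eq_zero_or_pos j with rfl | hj
    · simp [hg, wallis]
    · have hj0 : (j : ℝ) ≠ 0 := by positivity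
      simp only [hg, wallis_succ, hj.ne', if_false]
      push_cast
      field_simp
      ring
  -- `M` bounds the second derivative of the remainder on `[0, θ]`; two mean value estimates from 0
  -- give `M θ²`.
  set M : ℝ := 2 * (2 * N + 1) * Real.sin θ ^ (2 * N) with hM
  have hM0 : 0 ≤ M := mul_nonneg (by positivity) (by rw [pow_mul]; positivity)
  have d2 : ∀ x ∈ Set.Icc 0 θ, HasDerivWithinAt (fun x => 2 * x - ∑ j ∈ Finset.range (N + 1),
      g j * (2 * j * Real.sin x ^ (2 * j - 1) * Real.cos x))
      (4 * N ^ 2 * g N * Real.sin x ^ (2 * N)) (Set.Icc 0 θ) x := by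
    intro x _
    have h := ((hasDerivAt_id x).const_mul (2 : ℝ)).fun_sub
      (hasDerivAt_sum_sin_pow_mul_cos g (N + 1) x)
    refine HasDerivAt.hasDerivWithinAt ?_
    convert! h using 1
    rw [sum_second_deriv_sin_pow hrec]
    have : ∑ j ∈ Finset.range N, (if j = 0 then (2 : ℝ) else 0) * Real.sin x ^ (2 * j) = 2 := by
      rw [Finset.sum_eq_single 0]
      · simp
      · intro j _ hj; simp [hj]
      · intro h; simp at h; exact absurd h hN
    rw [this]; ring
  have b2 : ∀ x ∈ Set.Icc 0 θ, ‖4 * N ^ 2 * g N * Real.sin x ^ (2 * N)‖ ≤ M := by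
    intro x hx
    have hw := wallis_pos N
    have hN0 : (N : ℝ) ≠ 0 := by exact_mod_cast hN
    have h1 : 4 * (N : ℝ) ^ 2 * g N = 2 / wallis N := by
      simp only [hg]; field_simp; norm_num
    have h2 : 2 / wallis N ≤ 2 * (2 * N + 1) := by
      rw [div_le_iff₀ hw]; linarith [one_le_mul_wallis N]
    have h3 : 0 ≤ Real.sin x := Real.sin_nonneg_of_nonneg_of_le_pi hx.1
      (by linarith [hx.2, hθ.2, Real.pi_pos])
    have h4 : Real.sin x ≤ Real.sin θ := Real.sin_le_sin_of_le_of_le_pi_div_two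
      (by linarith [hx.1, Real.pi_pos]) hθ.2 hx.2
    rw [h1, Real.norm_of_nonneg (by positivity), hM]
    exact mul_le_mul h2 (pow_le_pow_left₀ h3 h4 _) (by positivity) (by positivity)
  have e0 : 2 * (0 : ℝ) - ∑ j ∈ Finset.range (N + 1),
      g j * (2 * j * Real.sin 0 ^ (2 * j - 1) * Real.cos 0) = 0 := by
    rw [mul_zero, Finset.sum_eq_zero, sub_zero]
    intro j _
    rcases j with _ | j
    · simp
    · simp [show 2 * (j + 1) - 1 = 2 * j + 1 by omega]
  have d1 : ∀ x ∈ Set.Icc 0 θ, HasDerivWithinAt (fun x => x ^ 2 - ∑ j ∈ Finset.range (N + 1),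
      g j * Real.sin x ^ (2 * j)) (2 * x - ∑ j ∈ Finset.range (N + 1),
      g j * (2 * j * Real.sin x ^ (2 * j - 1) * Real.cos x)) (Set.Icc 0 θ) x := by
    intro x _
    have h := (hasDerivAt_pow 2 x).fun_sub (hasDerivAt_sum_sin_pow g (N + 1) x)
    refine HasDerivAt.hasDerivWithinAt ?_
    convert! h using 1
    norm_num
  have b1 : ∀ x ∈ Set.Icc 0 θ, ‖2 * x - ∑ j ∈ Finset.range (N + 1),
      g j * (2 * j * Real.sin x ^ (2 * j - 1) * Real.cos x)‖ ≤ M * θ := by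
    intro x hx
    have h := (convex_Icc 0 θ).norm_image_sub_le_of_norm_hasDerivWithin_le d2 b2
      (Set.left_mem_Icc.2 hθ.1) hx
    rw [e0, sub_zero, sub_zero, Real.norm_of_nonneg hx.1] at h
    exact h.trans (mul_le_mul_of_nonneg_left hx.2 hM0)
  have h := (convex_Icc 0 θ).norm_image_sub_le_of_norm_hasDerivWithin_le d1 b1
      (Set.left_mem_Icc.2 hθ.1) (Set.right_mem_Icc.2 hθ.1)
  have e1 : (0 : ℝ) ^ 2 - ∑ j ∈ Finset.range (N + 1), g j * Real.sin 0 ^ (2 * j) = 0 := by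
    rw [Finset.sum_eq_zero]
    · norm_num
    · intro j _
      rcases j with _ | j
      · simp [hg]
      · simp [show 2 * (j + 1) = 2 * j + 2 by omega]
  rw [e1, sub_zero, sub_zero, Real.norm_of_nonneg hθ.1, Real.norm_eq_abs] at h
  calc _ ≤ _ := h
    _ = _ := by ring

theorem summable_pow_div_sq {u : ℝ} (hu : u ∈ Set.Icc (0 : ℝ) 1) :
    Summable fun j : ℕ => u ^ j / (j : ℝ) ^ 2 := by
  refine Summable.of_nonneg_of_le (fun j => div_nonneg (pow_nonneg hu.1 _) (by positivity))
    (fun j => ?_) (Real.summable_one_div_nat_pow.2 one_lt_two)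
  gcongr
  exact pow_le_one₀ hu.1 hu.2

/-- The Wallis factors cancel in the averaged `arcsin²` series. Strict `u < 1` makes the remainder,
of order `N u^N`, vanish. -/
theorem halfMean_amplitude_sq {u : ℝ} (hu : u ∈ Set.Ico (0 : ℝ) 1) :
    2 * halfMean (fun φ => amplitude u φ ^ 2) = ∑' j : ℕ, u ^ j / (j : ℝ) ^ 2 := by
  have hu' : u ∈ Set.Icc (0 : ℝ) 1 := ⟨hu.1, hu.2.le⟩
  have hcont := continuous_amplitude u
  have hlim := ((summable_pow_div_sq hu').hasSum.tendsto_sum_nat).comp (Filter.tendsto_add_atTop_nat 1)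
  refine tendsto_nhds_unique ?_ hlim
  have hz : Filter.Tendsto (fun N : ℕ => 2 * (2 * (2 * (N : ℝ) + 1) * u ^ N * (Real.pi / 2) ^ 2))
      Filter.atTop (nhds 0) := by
    have h1 := tendsto_self_mul_const_pow_of_lt_one hu.1 hu.2
    have h2 := tendsto_pow_atTop_nhds_zero_of_lt_one hu.1 hu.2
    have h3 := ((h1.const_mul 2).add h2).const_mul (4 * (Real.pi / 2) ^ 2)
    simp only [mul_zero, add_zero] at h3
    refine h3.congr fun N => ?_
    ring
  rw [← sub_zero (2 * halfMean _)]
  have key : ∀ᶠ N : ℕ in Filter.atTop, ‖2 * halfMean (fun φ => amplitude u φ ^ 2) -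
      ∑ j ∈ Finset.range (N + 1), u ^ j / (j : ℝ) ^ 2‖ ≤
        2 * (2 * (2 * (N : ℝ) + 1) * u ^ N * (Real.pi / 2) ^ 2) := by
    filter_upwards [Filter.eventually_ne_atTop 0] with N hN
    have h1 := halfMean_sum_sin_amplitude_pow hu'
      (fun j => 1 / (2 * (j : ℝ) ^ 2 * wallis j)) (N + 1)
    have h2 : ∑ j ∈ Finset.range (N + 1), u ^ j / (j : ℝ) ^ 2 =
        2 * halfMean (fun φ => ∑ j ∈ Finset.range (N + 1),
          1 / (2 * (j : ℝ) ^ 2 * wallis j) * Real.sin (amplitude u φ) ^ (2 * j)) := by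
      rw [h1, Finset.mul_sum]
      refine Finset.sum_congr rfl fun j _ => ?_
      have := (wallis_pos j).ne'
      rcases Nat.eq_zero_or_pos j with rfl | hj
      · simp
      · field_simp
    have h3 : 2 * halfMean (fun φ => amplitude u φ ^ 2) -
        ∑ j ∈ Finset.range (N + 1), u ^ j / (j : ℝ) ^ 2 =
        2 * halfMean (fun φ => amplitude u φ ^ 2 - ∑ j ∈ Finset.range (N + 1),
          1 / (2 * (j : ℝ) ^ 2 * wallis j) * Real.sin (amplitude u φ) ^ (2 * j)) := by
      rw [h2]
      simp only [halfMean]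
      rw [intervalIntegral.integral_sub]
      · ring
      · exact Continuous.intervalIntegrable (by fun_prop) _ _
      · exact Continuous.intervalIntegrable (by fun_prop) _ _
    rw [h3, norm_mul, Real.norm_of_nonneg (by norm_num : (0 : ℝ) ≤ 2), Real.norm_eq_abs]
    refine mul_le_mul_of_nonneg_left (abs_halfMean_le fun φ hφ => ?_) (by norm_num)
    have hm := amplitude_mem (u := u) (φ := φ) ⟨hφ.1.le, hφ.2⟩
    refine (abs_sq_sub_sum_sin_pow_le hm hN).trans ?_
    rw [pow_mul, sin_amplitude_sq hu']
    have h5 : u * Real.sin φ ^ 2 ≤ u := mul_le_of_le_one_right hu.1 (Real.sin_sq_le_one φ)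
    have h6 : 0 ≤ u * Real.sin φ ^ 2 := mul_nonneg hu.1 (sq_nonneg _)
    have h7 := hm.1
    have h8 := hm.2
    have h9 := hu.1
    gcongr
  have h := squeeze_zero_norm' key hz
  have h' := (tendsto_const_nhds (x := 2 * halfMean (fun φ => amplitude u φ ^ 2))).sub h
  refine h'.congr fun N => ?_
  simp

/-- The Fourier series of the second Bernoulli polynomial at `1/2 - θ/π`; the half-period shift
produces the signs. -/
theorem hasSum_alternating_cos {θ : ℝ} (hθ : θ ∈ Set.Icc 0 (Real.pi / 2)) :
    HasSum (fun m : ℕ => 2 * (-1) ^ (m + 1) / (m : ℝ) ^ 2 * Real.cos (2 * m * θ))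
      (Real.pi ^ 2 / 6 - 2 * θ ^ 2) := by
  have hpi := Real.pi_pos
  have h := hasSum_one_div_nat_pow_mul_cos one_ne_zero (x := 1 / 2 - θ / Real.pi)
    ⟨by
      have : θ / Real.pi ≤ 1 / 2 := by rw [div_le_iff₀ hpi]; linarith [hθ.2]
      linarith, by
      have : 0 ≤ θ / Real.pi := div_nonneg hθ.1 hpi.le
      linarith⟩
  have hb : (Polynomial.map (algebraMap ℚ ℝ) (Polynomial.bernoulli (2 * 1))).eval
      (1 / 2 - θ / Real.pi) = (θ / Real.pi) ^ 2 - 1 / 12 := by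
    simp_rw [Nat.mul_one, Polynomial.bernoulli, Finset.sum_range_succ, Polynomial.map_add,
      Polynomial.map_monomial, Polynomial.eval_add, Polynomial.eval_monomial]
    norm_num [bernoulli_one, bernoulli_two]
    ring
  have h2 := h.mul_left (-2)
  rw [hb] at h2
  convert! h2 using 1
  · ext m
    have : 2 * Real.pi * m * (1 / 2 - θ / Real.pi) = m * Real.pi - 2 * m * θ := by
      field_simp
    rw [this, Real.cos_sub, Real.cos_nat_mul_pi, Real.sin_nat_mul_pi]
    ring
  · norm_num [Nat.factorial]
    field_simp
    ring

theorem hasSum_eigenPoly_dilog {u : ℝ} (hu : u ∈ Set.Icc (0 : ℝ) 1) :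
    HasSum (fun m : ℕ => 2 * (-1) ^ (m + 1) / (m : ℝ) ^ 2 * (eigenPoly m).eval u)
      (Real.pi ^ 2 / 6 - ∑' j : ℕ, u ^ j / (j : ℝ) ^ 2) := by
  rcases hu.2.eq_or_lt with rfl | hu1
  · have h1 : ∑' j : ℕ, (1 : ℝ) ^ j / (j : ℝ) ^ 2 = Real.pi ^ 2 / 6 := by
      simpa using hasSum_zeta_two.tsum_eq
    rw [h1, sub_self]
    convert! hasSum_zero using 1
    ext m
    rcases Nat.eq_zero_or_pos m with rfl | hm
    · simp
    · simp [eval_one_eigenPoly hm.ne']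
  have hcont := continuous_amplitude u
  have hsum := intervalIntegral.hasSum_integral_of_dominated_convergence (μ := volume)
    (a := 0) (b := Real.pi)
    (F := fun (m : ℕ) φ => 2 * (-1) ^ (m + 1) / (m : ℝ) ^ 2 * Real.cos (2 * m * amplitude u φ))
    (f := fun φ => Real.pi ^ 2 / 6 - 2 * amplitude u φ ^ 2)
    (fun (m : ℕ) _ => 2 * (1 / (m : ℝ) ^ 2))
    (fun m => Continuous.aestronglyMeasurable (by fun_prop))
    (fun m => .of_forall fun φ _ => by
      rw [norm_mul, norm_div, norm_mul, norm_pow, norm_pow, norm_neg, norm_one, one_pow]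
      have := Real.abs_cos_le_one (2 * m * amplitude u φ)
      simp only [Real.norm_eq_abs, Nat.abs_cast, Nat.abs_ofNat]
      calc _ ≤ 2 * 1 / (m : ℝ) ^ 2 * 1 := by gcongr
        _ = _ := by ring)
    (.of_forall fun φ _ => (Real.summable_one_div_nat_pow.2 one_lt_two).mul_left 2)
    (by simp)
    (.of_forall fun φ hφ => by
      rw [Set.uIoc_of_le Real.pi_pos.le] at hφ
      exact hasSum_alternating_cos (amplitude_mem ⟨hφ.1.le, hφ.2⟩))
  have h2 := hsum.mul_left (1 / Real.pi)
  convert! h2 using 1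
  · ext m
    rw [← halfMean_cos_amplitude hu, halfMean, intervalIntegral.integral_const_mul]
    ring
  · rw [← halfMean_amplitude_sq ⟨hu.1, hu1⟩, halfMean, intervalIntegral.integral_sub,
      intervalIntegral.integral_const_mul, intervalIntegral.integral_const]
    · have := Real.pi_pos
      simp only [smul_eq_mul]
      field_simp
      ring
    · exact Continuous.intervalIntegrable (by fun_prop) _ _
    · exact Continuous.intervalIntegrable (by fun_prop) _ _

/-! ### Chain integrals and their link with the zigzag. -/

/-- The region `s + u₁ < 1`, `u₁ + u₂ < 1`, …, `uₙ₋₁ + uₙ < 1` in the open unit cube. -/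
def chainRegion (n : ℕ) (s : ℝ) : Set (Fin n → ℝ) :=
  {u | (∀ i, u i ∈ Set.Ioo (0 : ℝ) 1) ∧ (∀ i : Fin n, (i : ℕ) = 0 → u i + s < 1) ∧
    ∀ i j : Fin n, (j : ℕ) = i + 1 → u i + u j < 1}

theorem measurableSet_chainRegion (n : ℕ) (s : ℝ) : MeasurableSet (chainRegion n s) := by
  simp only [chainRegion, Set.ofPred_and, Set.ofPred_forall]
  refine .inter (.iInter fun i => measurableSet_Ioo.preimage (measurable_pi_apply i))
    (.inter (.iInter fun i => .iInter fun _ => ?_)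
      (.iInter fun i => .iInter fun j => .iInter fun _ => ?_)) <;>
  exact measurableSet_lt (by fun_prop) (by fun_prop)

/-- The integrand `∏ 1 / (1 - uᵢ)` cut off outside `chainRegion n s`. -/
noncomputable def chainIntegrand (n : ℕ) (s : ℝ) : (Fin n → ℝ) → ENNReal :=
  (chainRegion n s).indicator fun u => ∏ i, ENNReal.ofReal (1 / (1 - u i))

theorem measurable_chainIntegrand (n : ℕ) (s : ℝ) : Measurable (chainIntegrand n s) := by
  refine Measurable.indicator ?_ (measurableSet_chainRegion n s)
  fun_prop

theorem cons_mem_chainRegion {n : ℕ} {s : ℝ} (hs : 0 ≤ s) (x : ℝ) (v : Fin n → ℝ) :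
    (Fin.cons x v : Fin (n + 1) → ℝ) ∈ chainRegion (n + 1) s ↔
      x ∈ Set.Ioo 0 (1 - s) ∧ v ∈ chainRegion n x := by
  simp only [chainRegion, Set.mem_ofPred_eq, Fin.forall_fin_succ, Fin.cons_zero, Fin.cons_succ,
    Set.mem_Ioo, Fin.val_zero, Fin.val_succ]
  constructor
  · rintro ⟨⟨h1, h2⟩, ⟨h3, -⟩, ⟨-, h4⟩, h5⟩
    refine ⟨⟨h1.1, by linarith [h3 trivial]⟩, h2, fun i hi => ?_, fun i j hij => ?_⟩
    · linarith [h4 i (by omega)]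
    · exact (h5 i).2 j (by omega)
  · rintro ⟨h1, h2, h3, h4⟩
    refine ⟨⟨⟨h1.1, by linarith⟩, h2⟩, ⟨fun _ => by linarith, fun i hi => by omega⟩,
      ⟨fun h => by omega, fun j hj => ?_⟩, fun i => ⟨fun h => by omega, fun j hj => ?_⟩⟩
    · linarith [h3 j (by omega)]
    · exact h4 i j (by omega)

theorem lintegral_chainIntegrand_zero (s : ℝ) : ∫⁻ u, chainIntegrand 0 s u = 1 := by
  have : chainIntegrand 0 s = fun _ => 1 := by
    ext u
    rw [chainIntegrand, Set.indicator_of_mem]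
    · simp
    · exact ⟨fun i => i.elim0, fun i => i.elim0, fun i => i.elim0⟩
  rw [this]
  simp [volume_pi]

/-- Tonelli in the first coordinate, which becomes the parameter `s` for the remaining ones. -/
theorem lintegral_chainIntegrand_succ (n : ℕ) {s : ℝ} (hs : 0 ≤ s) :
    ∫⁻ u, chainIntegrand (n + 1) s u =
      ∫⁻ x in Set.Ioo 0 (1 - s), ENNReal.ofReal (1 / (1 - x)) * ∫⁻ v, chainIntegrand n x v := by
  have hmp := (volume_preserving_piFinSuccAbove (fun _ : Fin (n + 1) => ℝ) 0).symm
  rw [← hmp.lintegral_comp (measurable_chainIntegrand _ _), Measure.volume_eq_prod,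
    lintegral_prod (fun a => chainIntegrand (n + 1) s
      ((MeasurableEquiv.piFinSuccAbove (fun _ : Fin (n + 1) => ℝ) 0).symm a))
      ((measurable_chainIntegrand _ _).comp (MeasurableEquiv.measurable _)).aemeasurable,
    ← lintegral_indicator measurableSet_Ioo]
  refine lintegral_congr fun x => ?_
  have key : ∀ v : Fin n → ℝ, chainIntegrand (n + 1) s
      ((MeasurableEquiv.piFinSuccAbove (fun _ : Fin (n + 1) => ℝ) 0).symm (x, v)) =
      (Set.Ioo 0 (1 - s)).indicator (fun _ => ENNReal.ofReal (1 / (1 - x))) x *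
        chainIntegrand n x v := by
    intro v
    have : (MeasurableEquiv.piFinSuccAbove (fun _ : Fin (n + 1) => ℝ) 0).symm (x, v) =
        Fin.cons x v := by
      simp [MeasurableEquiv.piFinSuccAbove, Fin.insertNthEquiv]
    rw [this]
    classical
    simp only [chainIntegrand, Set.indicator_apply, cons_mem_chainRegion hs, Fin.prod_univ_succ,
      Fin.cons_zero, Fin.cons_succ]
    split_ifs <;> simp_all
  rw [lintegral_congr key, lintegral_const_mul _ (measurable_chainIntegrand _ _)]
  by_cases hx : x ∈ Set.Ioo 0 (1 - s) <;> simp [hx]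

/-- The reflection of the even-numbered coordinates `t₂, t₄, …`. -/
def zigzagReflection (n : ℕ) (t : Fin n → ℝ) (i : Fin n) : ℝ :=
  if Even (i : ℕ) then t i else 1 - t i

theorem measurePreserving_zigzagReflection (n : ℕ) :
    MeasurePreserving (zigzagReflection n) := by
  have := volume_preserving_pi (ι := Fin n) (α' := fun _ => ℝ) (β' := fun _ => ℝ)
    (f := fun i x => if Even (i : ℕ) then x else 1 - x) fun i => by
      split_ifs
      · exact MeasurePreserving.id _
      · exact Measure.measurePreserving_sub_left volume 1
  exact this

/-- Of two neighbours exactly one is reflected, so `tᵢ < tⱼ` becomes `uᵢ + uⱼ < 1`; at `s = 0` the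
initial constraint is vacuous. -/
theorem zigzagReflection_mem (n : ℕ) (t : Fin n → ℝ) :
    zigzagReflection n t ∈ chainRegion n 0 ↔ t ∈ zigzagRegion n := by
  have h01 : ∀ i, zigzagReflection n t i ∈ Set.Ioo (0 : ℝ) 1 ↔ t i ∈ Set.Ioo (0 : ℝ) 1 := by
    intro i
    unfold zigzagReflection
    split_ifs
    · rfl
    · simp only [Set.mem_Ioo]
      constructor <;> rintro ⟨h1, h2⟩ <;> constructor <;> linarith
  simp only [chainRegion, zigzagRegion, Set.mem_ofPred_eq, h01]
  refine and_congr_right fun h => ⟨fun ⟨_, h2⟩ i j hi hij => ?_, fun h2 => ⟨fun i _ => ?_, ?_⟩⟩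
  · rcases hij with hij | hij
    · have hj : ¬ Even (j : ℕ) := by rw [hij]; simpa [Nat.even_add_one] using hi
      have := h2 i j hij
      simp only [zigzagReflection, hi, hj, if_true, if_false] at this
      linarith
    · have hj : ¬ Even (j : ℕ) := fun hj => by
        rw [hij, Nat.even_add_one] at hi
        exact hi hj
      have := h2 j i hij
      simp only [zigzagReflection, hi, hj, if_true, if_false] at this
      linarith
  · simpa using ((h01 i).2 (h i)).2
  · intro i j hij
    by_cases hi : Even (i : ℕ)
    · have hj : ¬ Even (j : ℕ) := by rw [hij]; simpa [Nat.even_add_one] using hi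
      have := h2 i j hi (Or.inl hij)
      simp only [zigzagReflection, hi, hj, if_true, if_false]
      linarith
    · have hj : Even (j : ℕ) := by rw [hij]; simpa [Nat.even_add_one] using hi
      have := h2 j i hj (Or.inr hij)
      simp only [zigzagReflection, hi, hj, if_true, if_false]
      linarith

theorem measurableSet_zigzagRegion (n : ℕ) : MeasurableSet (zigzagRegion n) := by
  have : zigzagRegion n = zigzagReflection n ⁻¹' chainRegion n 0 := by
    ext t; exact (zigzagReflection_mem n t).symm
  rw [this]
  exact (measurePreserving_zigzagReflection n).measurable (measurableSet_chainRegion n 0)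

theorem zigzagDensity_nonneg {n : ℕ} {t : Fin n → ℝ} (ht : t ∈ zigzagRegion n) :
    0 ≤ zigzagDensity n t := by
  refine Finset.prod_nonneg fun i _ => ?_
  have := ht.1 i
  split_ifs
  · exact one_div_nonneg.2 (by linarith [this.2])
  · exact one_div_nonneg.2 this.1.le

theorem measurable_zigzagDensity (n : ℕ) : Measurable (zigzagDensity n) := by
  refine Finset.measurable_fun_prod _ fun i _ => ?_
  split_ifs <;> fun_prop

theorem lintegral_zigzag (n : ℕ) :
    ∫⁻ t in zigzagRegion n, ENNReal.ofReal (zigzagDensity n t) = ∫⁻ u, chainIntegrand n 0 u := by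
  rw [← (measurePreserving_zigzagReflection n).lintegral_comp (measurable_chainIntegrand n 0),
    ← lintegral_indicator (measurableSet_zigzagRegion n)]
  refine lintegral_congr fun t => ?_
  by_cases ht : t ∈ zigzagRegion n
  · rw [chainIntegrand, Set.indicator_of_mem ht,
      Set.indicator_of_mem ((zigzagReflection_mem n t).2 ht), zigzagDensity,
      ENNReal.ofReal_prod_of_nonneg]
    · refine Finset.prod_congr rfl fun i _ => ?_
      simp only [zigzagReflection]
      split_ifs <;> simp
    · intro i _
      have := ht.1 i
      split_ifs
      · exact one_div_nonneg.2 (by linarith [this.2])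
      · exact one_div_nonneg.2 this.1.le
  · rw [chainIntegrand, Set.indicator_of_notMem ht,
      Set.indicator_of_notMem (mt (zigzagReflection_mem n t).1 ht)]

/-- A finite value of the iterated integral gives integrability and the value of the integral. -/
theorem integral_zigzag {n : ℕ} {c : ℝ} (hc : 0 ≤ c)
    (h : ∫⁻ u, chainIntegrand n 0 u = ENNReal.ofReal c) :
    IntegrableOn (zigzagDensity n) (zigzagRegion n) volume ∧
      ∫ t in zigzagRegion n, zigzagDensity n t = c := by
  have hnn : 0 ≤ᵐ[volume.restrict (zigzagRegion n)] zigzagDensity n :=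
    (ae_restrict_iff' (measurableSet_zigzagRegion n)).2 (.of_forall fun _ => zigzagDensity_nonneg)
  have hm := (measurable_zigzagDensity n).aestronglyMeasurable
    (μ := volume.restrict (zigzagRegion n))
  refine ⟨⟨hm, ?_⟩, ?_⟩
  · rw [hasFiniteIntegral_iff_ofReal hnn, lintegral_zigzag, h]
    exact ENNReal.ofReal_lt_top
  · rw [integral_eq_lintegral_of_nonneg_ae hnn hm, lintegral_zigzag, h, ENNReal.toReal_ofReal hc]

/-! ### The eigenfunction series and its derivative. -/

/-- The coefficient of `eigenPoly m` in the `n`-fold iterated integral. -/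
noncomputable def iterCoeff (n m : ℕ) : ℝ := 2 * m * ((-1) ^ (m + 1) / (m : ℝ)) ^ (n + 1)

theorem abs_iterCoeff (n m : ℕ) (hn : n ≠ 0) : |iterCoeff n m| = 2 * (1 / (m : ℝ) ^ n) := by
  rw [iterCoeff, abs_mul, abs_pow, abs_div, abs_pow, abs_neg, abs_one, one_pow, Nat.abs_cast,
    abs_of_nonneg (by positivity)]
  rcases Nat.eq_zero_or_pos m with rfl | hm
  · simp [hn]
  · rw [div_pow, one_pow, pow_succ (m : ℝ)]
    field_simp

/-- The `n`-fold iterated integral as an eigenfunction expansion. -/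
noncomputable def iterSeries (n : ℕ) (u : ℝ) : ℝ := ∑' m : ℕ, iterCoeff n m * (eigenPoly m).eval u

theorem norm_iterCoeff_mul_le (n m : ℕ) (hn : n ≠ 0) {u : ℝ} (hu : u ∈ Set.Icc (0 : ℝ) 1) :
    ‖iterCoeff n m * (eigenPoly m).eval u‖ ≤ 2 * (1 / (m : ℝ) ^ n) := by
  rw [norm_mul, Real.norm_eq_abs, Real.norm_eq_abs, abs_iterCoeff n m hn]
  exact mul_le_of_le_one_right (by positivity) (abs_eval_eigenPoly_le hu m)

theorem summable_iterSeries {n : ℕ} (hn : 2 ≤ n) {u : ℝ} (hu : u ∈ Set.Icc (0 : ℝ) 1) :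
    Summable fun m : ℕ => iterCoeff n m * (eigenPoly m).eval u :=
  Summable.of_norm_bounded ((Real.summable_one_div_nat_pow.2 (by omega)).mul_left 2)
    fun m => norm_iterCoeff_mul_le n m (by omega) hu

theorem continuousOn_iterSeries {n : ℕ} (hn : 2 ≤ n) :
    ContinuousOn (iterSeries n) (Set.Icc 0 1) :=
  continuousOn_tsum (fun m => (continuous_const.mul (eigenPoly m).continuous).continuousOn)
    ((Real.summable_one_div_nat_pow.2 (by omega : 1 < n)).mul_left 2)
    fun m _ hu => norm_iterCoeff_mul_le n m (by omega) hu

theorem iterSeries_one (n : ℕ) : iterSeries n 1 = 0 := by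
  rw [iterSeries]
  refine (tsum_congr fun m => ?_).trans tsum_zero
  rcases Nat.eq_zero_or_pos m with rfl | hm
  · simp [iterCoeff]
  · rw [eval_one_eigenPoly hm.ne', mul_zero]

theorem iterSeries_two {u : ℝ} (hu : u ∈ Set.Icc (0 : ℝ) 1) :
    iterSeries 2 u = Real.pi ^ 2 / 6 - ∑' j : ℕ, u ^ j / (j : ℝ) ^ 2 := by
  rw [← (hasSum_eigenPoly_dilog hu).tsum_eq, iterSeries]
  refine tsum_congr fun m => ?_
  rcases Nat.eq_zero_or_pos m with rfl | hm
  · simp [iterCoeff]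
  · have h : ((-1 : ℝ) ^ (m + 1)) ^ 3 = (-1) ^ (m + 1) := by
      rcases neg_one_pow_eq_or ℝ (m + 1) with h | h <;> rw [h] <;> norm_num
    rw [iterCoeff, div_pow, h]
    field_simp

theorem hasDerivAt_iterSeries {n : ℕ} (hn : 2 ≤ n) {x : ℝ} (hx : x ∈ Set.Ioo (0 : ℝ) 1) :
    HasDerivAt (iterSeries (n + 1)) (-(iterSeries n (1 - x) / x)) x := by
  -- Working on `(x/2, 1)` keeps the factor `1/y` bounded, which permits termwise differentiation.
  have hsum : Summable fun m : ℕ => 2 * (1 / (m : ℝ) ^ n) / (x / 2) :=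
    ((Real.summable_one_div_nat_pow.2 (by omega : 1 < n)).mul_left 2).div_const _
  have hder : ∀ (m : ℕ) (y : ℝ), y ∈ Set.Ioo (x / 2) 1 →
      iterCoeff (n + 1) m * (eigenPoly m).derivative.eval y =
        -(iterCoeff n m * (eigenPoly m).eval (1 - y) / y) := by
    intro m y hy
    have hy0 : y ≠ 0 := (show (0 : ℝ) < y by linarith [hy.1, hx.1]).ne'
    rcases Nat.eq_zero_or_pos m with rfl | hm
    · simp [iterCoeff]
    have h := eval_derivative_eigenPoly m y
    have h2 : (eigenPoly m).derivative.eval y =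
        (-1) ^ m * m * (eigenPoly m).eval (1 - y) / y := by
      rw [← h]; field_simp
    have h3 : ((-1 : ℝ) ^ m) * (-1) ^ m = 1 := by rw [← mul_pow]; norm_num
    rw [h2, iterCoeff, iterCoeff, pow_succ _ (n + 1)]
    have h4 : ((-1 : ℝ) ^ (m + 1) / (m : ℝ)) * ((-1) ^ m * m) = -1 := by
      field_simp
      rw [pow_succ]; linear_combination -h3
    linear_combination (2 * m * ((-1) ^ (m + 1) / (m : ℝ)) ^ (n + 1) *
      (eigenPoly m).eval (1 - y) / y) * h4
  have h := hasDerivAt_tsum_of_isPreconnected hsum (isOpen_Ioo (a := x / 2) (b := 1))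
    isPreconnected_Ioo
    (g := fun m y => iterCoeff (n + 1) m * (eigenPoly m).eval y)
    (g' := fun m y => iterCoeff (n + 1) m * (eigenPoly m).derivative.eval y)
    (fun m y _ => ((eigenPoly m).hasDerivAt y).const_mul _)
    (fun m y hy => by
      have hy0 : 0 < y := by linarith [hy.1, hx.1]
      rw [hder m y hy, norm_neg, norm_div, Real.norm_of_nonneg hy0.le]
      have := norm_iterCoeff_mul_le n m (by omega) (u := 1 - y)
        ⟨by linarith [hy.2], by linarith⟩
      have hx2 : 0 < x / 2 := by linarith [hx.1]
      have := hy.1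
      gcongr)
    (y₀ := x) ⟨by linarith [hx.1], hx.2⟩
    (summable_iterSeries (by omega) ⟨hx.1.le, hx.2.le⟩)
    (y := x) ⟨by linarith [hx.1], hx.2⟩
  convert! h using 1
  rw [tsum_congr fun m => hder m x ⟨by linarith [hx.1], hx.2⟩, tsum_neg, tsum_div_const,
    iterSeries]

/-- Differentiating the eigenfunction series would leave coefficients of size `2/m`, not absolutely
summable, so the dilogarithm form is differentiated instead. -/
theorem hasDerivAt_iterSeries_two {x : ℝ} (hx : x ∈ Set.Ioo (0 : ℝ) 1) :
    HasDerivAt (iterSeries 2) (-(-Real.log (1 - x) / x)) x := by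
  set r := (1 + x) / 2 with hr
  have hr0 : 0 < r := by rw [hr]; linarith [hx.1]
  have hr1 : r < 1 := by rw [hr]; linarith [hx.2]
  have hxr : x < r := by rw [hr]; linarith [hx.2]
  have hsum : Summable fun j : ℕ => r ^ j / r :=
    (summable_geometric_of_lt_one hr0.le hr1).div_const _
  have h := hasDerivAt_tsum_of_isPreconnected hsum (isOpen_Ioo (a := 0) (b := r))
    isPreconnected_Ioo
    (g := fun (j : ℕ) y => y ^ j / (j : ℝ) ^ 2)
    (g' := fun (j : ℕ) y => j * y ^ (j - 1) / (j : ℝ) ^ 2)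
    (fun j y _ => (hasDerivAt_pow j y).div_const _)
    (fun j y hy => by
      rcases j with _ | j
      · simp [hr0.le]
      · rw [Real.norm_of_nonneg (div_nonneg (mul_nonneg (by positivity) (pow_nonneg hy.1.le _))
          (by positivity)), Nat.add_sub_cancel, pow_succ r, mul_div_cancel_right₀ _ hr0.ne']
        have h1 : y ^ j ≤ r ^ j := pow_le_pow_left₀ hy.1.le hy.2.le j
        have h2 : 0 ≤ y ^ j := pow_nonneg hy.1.le j
        rw [div_le_iff₀ (by positivity)]
        have h3 : (1 : ℝ) ≤ ((j + 1 : ℕ) : ℝ) := by exact_mod_cast Nat.succ_pos j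
        nlinarith [mul_nonneg (sub_nonneg.2 h1) (sq_nonneg (((j + 1 : ℕ) : ℝ))),
          mul_nonneg h2 (mul_nonneg (sub_nonneg.2 h3) (by linarith : (0:ℝ) ≤ ((j + 1 : ℕ) : ℝ)))])
    (y₀ := x) ⟨hx.1, hxr⟩ (summable_pow_div_sq ⟨hx.1.le, hx.2.le⟩) (y := x) ⟨hx.1, hxr⟩
  have hlog : ∑' j : ℕ, (j : ℝ) * x ^ (j - 1) / (j : ℝ) ^ 2 = -Real.log (1 - x) / x := by
    have h1 := (Real.hasSum_pow_div_log_of_abs_lt_one (x := x)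
      (by rw [abs_of_pos hx.1]; exact hx.2)).div_const x
    have h2 : HasSum (fun j : ℕ => ((j + 1 : ℕ) : ℝ) * x ^ (j + 1 - 1) / ((j + 1 : ℕ) : ℝ) ^ 2)
        (-Real.log (1 - x) / x) := by
      convert! h1 using 1
      ext j
      have := hx.1.ne'
      rw [Nat.add_sub_cancel]
      push_cast
      field_simp
      rw [pow_succ]
    have h3 := (hasSum_nat_add_iff' (f := fun j : ℕ => (j : ℝ) * x ^ (j - 1) / (j : ℝ) ^ 2)
      1).1 (by simpa using h2)
    exact h3.tsum_eq
  rw [hlog] at h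
  have h2 := h.const_sub (Real.pi ^ 2 / 6)
  refine h2.congr_of_eventuallyEq ?_
  filter_upwards [isOpen_Ioo.mem_nhds hx] with y hy
  exact iterSeries_two ⟨hy.1.le, hy.2.le⟩

/-! ### Induction on the number of variables. -/

/-- The fundamental theorem of calculus for one step of the iterated integral. -/
theorem lintegral_step {F g : ℝ → ℝ} {s : ℝ} (hs : s ∈ Set.Ico (0 : ℝ) 1)
    (hF : ContinuousOn F (Set.Icc s 1)) (hF1 : F 1 = 0)
    (hd : ∀ x ∈ Set.Ioo (0 : ℝ) 1, HasDerivAt F (-(g (1 - x) / x)) x)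
    (hg : ∀ x ∈ Set.Ioo (0 : ℝ) 1, 0 ≤ g x) :
    0 ≤ F s ∧ ∫⁻ u in Set.Ioo 0 (1 - s), ENNReal.ofReal (1 / (1 - u)) * ENNReal.ofReal (g u) =
      ENNReal.ofReal (F s) := by
  have hle : 0 ≤ 1 - s := by linarith [hs.2]
  have hcont : ContinuousOn (fun v => F (1 - v)) (Set.Icc 0 (1 - s)) :=
    hF.comp (by fun_prop) fun v hv => ⟨by linarith [hv.2], by linarith [hv.1]⟩
  have hlt : ∀ v ∈ Set.Ioo 0 (1 - s), v < 1 := fun v hv => by linarith [hv.2, hs.1]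
  have hderiv : ∀ v ∈ Set.Ioo 0 (1 - s), HasDerivAt (fun v => F (1 - v)) (g v / (1 - v)) v := by
    intro v hv
    have h1 := hd (1 - v) ⟨by linarith [hlt v hv], by linarith [hv.1]⟩
    have h2 := h1.comp_const_sub 1 v
    simpa using h2
  have hpos : ∀ v ∈ Set.Ioo 0 (1 - s), 0 ≤ g v / (1 - v) := fun v hv =>
    div_nonneg (hg v ⟨hv.1, hlt v hv⟩) (by linarith [hlt v hv])
  -- Nonnegativity of the derivative and continuity up to the endpoints give integrability, even for
  -- the logarithmic singularity of `g`.
  have hint := intervalIntegral.integrableOn_deriv_of_nonneg hcont hderiv hpos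
  have hftc := intervalIntegral.integral_eq_sub_of_hasDerivAt_of_le hle hcont hderiv
    ((intervalIntegrable_iff_integrableOn_Ioc_of_le hle).2 hint)
  have hpos' : 0 ≤ᵐ[volume.restrict (Set.Ioo 0 (1 - s))] fun v => g v / (1 - v) :=
    (ae_restrict_iff' measurableSet_Ioo).2 (.of_forall hpos)
  rw [intervalIntegral.integral_of_le hle, integral_Ioc_eq_integral_Ioo] at hftc
  simp only [sub_sub_cancel, sub_zero, hF1] at hftc
  refine ⟨hftc ▸ integral_nonneg_of_ae hpos', ?_⟩
  rw [← hftc, ofReal_integral_eq_lintegral_ofReal (hint.mono_set Set.Ioo_subset_Ioc_self) hpos']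
  refine setLIntegral_congr_fun measurableSet_Ioo fun v hv => ?_
  have h1 : 0 ≤ 1 / (1 - v) := one_div_nonneg.2 (by linarith [hlt v hv])
  rw [← ENNReal.ofReal_mul h1, one_div_mul_eq_div]

theorem lintegral_chainIntegrand_one {s : ℝ} (hs : s ∈ Set.Ioo (0 : ℝ) 1) :
    ∫⁻ u, chainIntegrand 1 s u = ENNReal.ofReal (-Real.log s) := by
  rw [lintegral_chainIntegrand_succ 0 hs.1.le]
  have h := (lintegral_step (F := fun x => -Real.log x) (g := fun _ => 1) (s := s)
    ⟨hs.1.le, hs.2⟩ ((Real.continuousOn_log.mono fun x hx =>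
      (show (0 : ℝ) < x by linarith [hx.1, hs.1]).ne').neg) (by simp)
    (fun x hx => by
      simpa using (Real.hasDerivAt_log hx.1.ne').fun_neg) (fun _ _ => zero_le_one)).2
  rw [← h]
  simp [lintegral_chainIntegrand_zero]

/-- Each step solves `Iₙ₊₁'(s) = -Iₙ(1-s)/s`, `Iₙ₊₁(1) = 0`. Nonnegativity is carried along because
`ENNReal.ofReal` truncates. -/
theorem lintegral_chainIntegrand {n : ℕ} (hn : 2 ≤ n) :
    ∀ s ∈ Set.Ico (0 : ℝ) 1, 0 ≤ iterSeries n s ∧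
      ∫⁻ u, chainIntegrand n s u = ENNReal.ofReal (iterSeries n s) := by
  induction n, hn using Nat.le_induction with
  | base =>
    intro s hs
    have h := lintegral_step hs
      ((continuousOn_iterSeries le_rfl).mono (Set.Icc_subset_Icc_left hs.1)) (iterSeries_one 2)
      (g := fun x => -Real.log x) (fun x hx => hasDerivAt_iterSeries_two hx)
      (fun x hx => neg_nonneg.2 (Real.log_nonpos hx.1.le hx.2.le))
    refine ⟨h.1, ?_⟩
    rw [← h.2, lintegral_chainIntegrand_succ 1 hs.1]
    refine setLIntegral_congr_fun measurableSet_Ioo fun x hx => ?_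
    rw [lintegral_chainIntegrand_one ⟨hx.1, by linarith [hx.2, hs.1]⟩]
  | succ n hn ih =>
    intro s hs
    have h := lintegral_step hs
      ((continuousOn_iterSeries (by omega : 2 ≤ n + 1)).mono (Set.Icc_subset_Icc_left hs.1))
      (iterSeries_one (n + 1)) (g := iterSeries n) (fun x hx => hasDerivAt_iterSeries hn hx)
      (fun x hx => (ih x ⟨hx.1.le, hx.2⟩).1)
    refine ⟨h.1, ?_⟩
    rw [← h.2, lintegral_chainIntegrand_succ n hs.1]
    refine setLIntegral_congr_fun measurableSet_Ioo fun x hx => ?_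
    rw [(ih x ⟨hx.1.le, by linarith [hx.2, hs.1]⟩).2]

theorem integral_zigzag_eq {n : ℕ} (hn : 2 ≤ n) :
    IntegrableOn (zigzagDensity n) (zigzagRegion n) volume ∧
      ∫ t in zigzagRegion n, zigzagDensity n t = ∑' m : ℕ, iterCoeff n m := by
  have h := lintegral_chainIntegrand hn 0 ⟨le_rfl, zero_lt_one⟩
  have h2 := integral_zigzag h.1 h.2
  simpa only [iterSeries, eval_zero_eigenPoly, mul_one] using h2

/-! ### Evaluation at zero in terms of zeta values. -/

theorem tsum_iterCoeff_odd (k : ℕ) :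
    ∑' m : ℕ, iterCoeff (2 * k + 1) m = 2 * ∑' m : ℕ, 1 / (m : ℝ) ^ (2 * k + 1) := by
  rw [← tsum_mul_left]
  refine tsum_congr fun m => ?_
  rcases Nat.eq_zero_or_pos m with rfl | hm
  · simp [iterCoeff]
  · have h : ((-1 : ℝ) ^ (m + 1)) ^ (2 * k + 1 + 1) = 1 := by
      rw [← pow_mul]; exact Even.neg_one_pow ⟨(m + 1) * (k + 1), by ring⟩
    rw [iterCoeff, div_pow, h, pow_succ (m : ℝ) (2 * k + 1)]
    field_simp

theorem tsum_iterCoeff_even {k : ℕ} (hk : 1 ≤ k) :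
    ∑' m : ℕ, iterCoeff (2 * k) m =
      2 * (1 - (2 : ℝ) ^ (1 - 2 * (k : ℤ))) * ∑' m : ℕ, 1 / (m : ℝ) ^ (2 * k) := by
  have hz := (Real.summable_one_div_nat_pow.2 (by omega : 1 < 2 * k))
  have hcoeff : ∀ m : ℕ, iterCoeff (2 * k) m = 2 * ((-1) ^ (m + 1) * (1 / (m : ℝ) ^ (2 * k))) := by
    intro m
    rcases Nat.eq_zero_or_pos m with rfl | hm
    · simp [iterCoeff]; omega
    · have h : ((-1 : ℝ) ^ (m + 1)) ^ (2 * k + 1) = (-1) ^ (m + 1) := by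
        rw [← pow_mul, mul_comm, pow_mul, Odd.neg_one_pow ⟨k, rfl⟩]
      rw [iterCoeff, div_pow, h, pow_succ (m : ℝ)]
      field_simp
  have he : Summable fun m : ℕ => 1 / ((2 * m : ℕ) : ℝ) ^ (2 * k) :=
    hz.comp_injective (i := fun m => 2 * m) fun a b h => by simpa using h
  have ho : Summable fun m : ℕ => 1 / ((2 * m + 1 : ℕ) : ℝ) ^ (2 * k) :=
    hz.comp_injective (i := fun m => 2 * m + 1) fun a b h => by simpa using h
  have h1 := tsum_even_add_odd (f := fun m : ℕ => 1 / (m : ℝ) ^ (2 * k)) he ho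
  have h2 : ∑' m : ℕ, 1 / ((2 * m : ℕ) : ℝ) ^ (2 * k) =
      (2 ^ (2 * k))⁻¹ * ∑' m : ℕ, 1 / (m : ℝ) ^ (2 * k) := by
    rw [← tsum_mul_left]
    refine tsum_congr fun m => ?_
    push_cast
    rw [mul_pow, one_div, mul_inv, one_div]
  have h3 : HasSum (fun m : ℕ => (-1 : ℝ) ^ (m + 1) * (1 / (m : ℝ) ^ (2 * k)))
      (-(∑' m : ℕ, 1 / ((2 * m : ℕ) : ℝ) ^ (2 * k)) +
        ∑' m : ℕ, 1 / ((2 * m + 1 : ℕ) : ℝ) ^ (2 * k)) := by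
    refine HasSum.even_add_odd ?_ ?_
    · convert! he.hasSum.neg using 1
      ext m
      rw [Odd.neg_one_pow ⟨m, rfl⟩, neg_one_mul]
    · convert! ho.hasSum using 1
      ext m
      rw [Even.neg_one_pow ⟨m + 1, by ring⟩, one_mul]
  have h4 : (2 : ℝ) ^ (1 - 2 * (k : ℤ)) = 2 * (2 ^ (2 * k))⁻¹ := by
    rw [zpow_sub₀ two_ne_zero, zpow_one, div_eq_mul_inv]
    norm_cast
  rw [tsum_congr hcoeff, tsum_mul_left, h3.tsum_eq, h4]
  -- Alternating sum = full sum minus twice its even part, and the even part is `2^(-2k)` times the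
  -- full sum.
  linear_combination 2 * h1 - 4 * h2

theorem mainTheorem8 (k : ℕ) (hk : 1 ≤ k) :
    (IntegrableOn (zigzagDensity (2 * k)) (zigzagRegion (2 * k)) volume ∧
      riemannZeta (2 * (k : ℂ)) =
        ((1 / (2 * (1 - (2 : ℝ) ^ (1 - 2 * (k : ℤ)))) *
          ∫ t in zigzagRegion (2 * k), zigzagDensity (2 * k) t : ℝ) : ℂ)) ∧
    (IntegrableOn (zigzagDensity (2 * k + 1)) (zigzagRegion (2 * k + 1)) volume ∧
      riemannZeta (2 * (k : ℂ) + 1) =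
        ((1 / 2 * ∫ t in zigzagRegion (2 * k + 1), zigzagDensity (2 * k + 1) t : ℝ) : ℂ)) := by
  have hzeta : ∀ n : ℕ, 1 < n → riemannZeta n = ((∑' m : ℕ, 1 / (m : ℝ) ^ n : ℝ) : ℂ) := by
    intro n hn
    rw [zeta_nat_eq_tsum_of_gt_one hn]
    push_cast
    rfl
  have heven := integral_zigzag_eq (n := 2 * k) (by omega)
  have hodd := integral_zigzag_eq (n := 2 * k + 1) (by omega)
  refine ⟨⟨heven.1, ?_⟩, hodd.1, ?_⟩
  · have hz := hzeta (2 * k) (by omega)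
    have hne : 1 - (2 : ℝ) ^ (1 - 2 * (k : ℤ)) ≠ 0 := by
      have : (2 : ℝ) ^ (1 - 2 * (k : ℤ)) < 1 := zpow_lt_one_of_neg₀ one_lt_two (by omega)
      exact (sub_pos.2 this).ne'
    rw [heven.2, tsum_iterCoeff_even hk]
    push_cast at hz ⊢
    rw [hz]
    have hne' : (1 : ℂ) - (2 : ℂ) ^ (1 - 2 * (k : ℤ)) ≠ 0 := by
      simpa only [Complex.ofReal_sub, Complex.ofReal_one, Complex.ofReal_zpow,
        Complex.ofReal_ofNat] using Complex.ofReal_ne_zero.2 hne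
    field_simp
  · have hz := hzeta (2 * k + 1) (by omega)
    rw [hodd.2, tsum_iterCoeff_odd k]
    push_cast at hz ⊢
    rw [hz]
    ring
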